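/- Let $Z$ be a real inner product space with an isometric complex structure $\sigma$ ($\sigma^2=-1$) and vectors $z_1,z_2,\dots$ such that $\{z_k,\sigma(z_k)\}_{k\ge1}$ is an orthonormal system with dense linear span in $Z$. Let $C(Z)$ be the real Clifford algebra with relations $zw+wz+2(z,w)1=0$, and $C_{\mathbb C}(Z)=\mathbb C\otimes_{\mathbb R} C(Z)$. Let $X=\{0,1\}^{\mathbb N}$, with sequences $x=(x_1,x_2,\dots)$, be the compact group with addition mod $2$ in each component, $\delta_k\in X$ the sequence whose only nonzero component is a $1$ in position $k$, $\mathbf 1=(1,1,\dots)$, and $\mu$ a Haar measure on $X$. Define $c_k:X\to\mathbb C$, $k\ge1$, by $$c_{2\ell}(x)=1,\qquad c_{4\ell+1}(x)=(-1)^{x_{4\ell+3}},\qquad c_{4\ell+3}(x)=(-1)^{x_{4\ell+1}}.$$ A subspace is called invariant if it is mapped into itself by all operators of the representation, and a representation by bounded operators is irreducible if the space is nonzero and its only closed invariant subspaces are $0$ and the whole space. **Theorem 3.11.** 1. The $c_k$ are measurable, $|c_k(x)|=1$, $\overline{c_k(x)}=c_k(x+\delta_k)$, and $c_k(x)c_l(x+\delta_k)=c_l(x)c_k(x+\delta_l)$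 for all $k,l,x$. 2. There is a unique representation $\mathbb J$ of $C_{\mathbb C}(Z)$ by bounded operators on $L_2(X)=L_2(X,\mu;\mathbb C)$ such that each $\mathbb J_z$, $z\in Z$, is skew-hermitian and, for all $k$, all $f\in L_2(X)$ and almost all $x$, $$(\mathbb J_{z_k}f)(x)=(-1)^{x_1+\dots+x_{k-1}+1}\,i\,c_k(x)\sqrt{\tfrac{d\mu(x+\delta_k)}{d\mu(x)}}\,f(x+\delta_k),\qquad (\mathbb J_{\sigma(z_k)}f)(x)=(-1)^{x_k}\,i\,(\mathbb J_{z_k}f)(x).$$ (Here $d\mu(x+\delta_k)/d\mu(x)$ is the Radon–Nikodym derivative of the translated measure, which is $1$ almost everywhere.) 3. The representation $\mathbb J$ is irreducible over $\mathbb C$. 4. The real subspace $L_2(X)^{\mathbb R}=\{f\in L_2(X): f(\mathbf 1-x)=\overline{f(x)}\text{ for almost all }x\}$ is invariant under $C(Z)$, and the real representation of $C(Z)$ on it is irreducible over $\mathbb R$. 5. This real representation does not arise from any representation of $C_{\mathbb C}(Z)$ by restriction of scalars: for every complex Hilbert space $W$ and every representation $\tau$ of $C_{\mathbb C}(Z)$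 by bounded operators on $W$, there is no $\mathbb R$-linear homeomorphism $\varphi:L_2(X)^{\mathbb R}\to W$ with $\varphi(af)=\tau(1\otimes a)\varphi(f)$ for all $a\in C(Z)$ and $f\in L_2(X)^{\mathbb R}$. -/

import Mathlib

open MeasureTheory Filter TensorProduct
open scoped ENNReal ComplexConjugate

/-- The group `X = {0,1}^ℕ` of binary sequences `x = (x₁, x₂, …)` under componentwise addition
modulo `2`. -/
abbrev BinSeq : Type := ℕ+ → ZMod 2

/-- The sequence `δ_k` whose `k`-th component is `1` and whose other components are `0`. -/
def BinSeq.delta (k : ℕ+) : BinSeq := Pi.single k 1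

/-- The sign `(-1)^a` of an element `a` of `{0,1}`. -/
noncomputable def bitSign (a : ZMod 2) : ℂ := (-1) ^ a.val

/-- The functions `c_{2ℓ}(x) = 1`, `c_{4ℓ+1}(x) = (-1)^{x_{4ℓ+3}}`,
`c_{4ℓ+3}(x) = (-1)^{x_{4ℓ+1}}`. -/
noncomputable def splitCoeff (k : ℕ+) (x : BinSeq) : ℂ :=
  if (k : ℕ) % 4 = 1 then bitSign (x (k + 2))
  else if (k : ℕ) % 4 = 3 then bitSign (x (k - 2))
  else 1

/-- The conditions on the coefficients of a Gårding-Wightman module with one-dimensional fibres: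
the `c_k` are measurable functions into the unit circle with `c_k(x)^* = c_k(x + δ_k)` and
`c_k(x) c_l(x + δ_k) = c_l(x) c_k(x + δ_l)`. -/
structure IsGWCoeff (c : ℕ+ → BinSeq → ℂ) : Prop where
  measurable : ∀ k, Measurable (c k)
  norm_eq_one : ∀ k x, ‖c k x‖ = 1
  conj_eq : ∀ k x, conj (c k x) = c k (x + BinSeq.delta k)
  cocycle : ∀ k l x,
    c k x * c l (x + BinSeq.delta k) = c l x * c k (x + BinSeq.delta l)

/-- The Gårding-Wightman formula for the action of the basis vector `z_k`:
`(-1)^{x₁ + ⋯ + x_{k-1} + 1} i c_k(x) √(dμ(x + δ_k)/dμ(x)) f(x + δ_k)`. -/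
noncomputable def gwFormula (μ : Measure BinSeq) (c : ℕ+ → BinSeq → ℂ) (k : ℕ+)
    (f : BinSeq → ℂ) (x : BinSeq) : ℂ :=
  (-1) ^ ((∑ j ∈ Finset.Iio k, (x j).val) + 1) * Complex.I * c k x *
    (Real.sqrt (((μ.map (fun y => y + BinSeq.delta k)).rnDeriv μ x).toReal) : ℂ) *
    f (x + BinSeq.delta k)

section Clifford

variable (Z : Type*) [NormedAddCommGroup Z] [InnerProductSpace ℝ Z]

/-- The quadratic form `z ↦ -(z, z)`. -/
noncomputable def negNormSq : QuadraticForm ℝ Z :=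
  -LinearMap.BilinMap.toQuadraticMap (innerₗ Z)

/-- The real Clifford algebra `C(Z)`, with relations `z w + w z + 2 (z, w) = 0`. -/
abbrev RealCl : Type _ := CliffordAlgebra (negNormSq Z)

/-- The complexified Clifford algebra `ℂ ⊗ C(Z)`. -/
abbrev CplxCl : Type _ := ℂ ⊗[ℝ] RealCl Z

variable {Z}

/-- The generator of `C(Z)` given by `z ∈ Z`. -/
noncomputable def clGen (z : Z) : RealCl Z := CliffordAlgebra.ι (negNormSq Z) z

/-- A representation of `ℂ ⊗ C(Z)` by bounded operators on a complex Hilbert space for which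
`Z` acts by skew-hermitian operators. -/
def IsSkewRep {H : Type*} [NormedAddCommGroup H] [InnerProductSpace ℂ H] [CompleteSpace H]
    (ρ : CplxCl Z →ₐ[ℂ] (H →L[ℂ] H)) : Prop :=
  ∀ z : Z, ContinuousLinearMap.adjoint (ρ (1 ⊗ₜ[ℝ] clGen z)) = -ρ (1 ⊗ₜ[ℝ] clGen z)

/-- `ρ` is given on the real basis `z_k`, `σ(z_k)` of `Z` by the Gårding-Wightman formulas
with parameters `(μ, 1, {c_k})`. -/
structure IsGWRep (σ : Z →ₗᵢ[ℝ] Z) (z : ℕ+ → Z) (μ : Measure BinSeq) (c : ℕ+ → BinSeq → ℂ)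
    (ρ : CplxCl Z →ₐ[ℂ] (Lp ℂ 2 μ →L[ℂ] Lp ℂ 2 μ)) : Prop where
  skew : IsSkewRep ρ
  apply_basis : ∀ (k : ℕ+) (f : Lp ℂ 2 μ),
    ρ (1 ⊗ₜ[ℝ] clGen (z k)) f =ᵐ[μ] gwFormula μ c k f
  apply_sigma_basis : ∀ (k : ℕ+) (f : Lp ℂ 2 μ),
    ρ (1 ⊗ₜ[ℝ] clGen (σ (z k))) f =ᵐ[μ]
      fun x => bitSign (x k) * Complex.I * ρ (1 ⊗ₜ[ℝ] clGen (z k)) f x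

end Clifford

/-- (Topological) irreducibility of an algebra of bounded operators: the space is nonzero and
has no closed invariant subspaces other than `0` and itself. -/
def IsIrredRep {𝕜 A V : Type*} [NontriviallyNormedField 𝕜] [Ring A] [Algebra 𝕜 A]
    [NormedAddCommGroup V] [NormedSpace 𝕜 V] (ρ : A →ₐ[𝕜] (V →L[𝕜] V)) : Prop :=
  Nontrivial V ∧ ∀ U : Submodule 𝕜 V, IsClosed (U : Set V) →
    (∀ a : A, ∀ v ∈ U, ρ a v ∈ U) → U = ⊥ ∨ U = ⊤

theorem BinSeq.quasiMeasurePreserving_one_sub (μ : Measure BinSeq) [μ.IsAddHaarMeasure] :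
    Measure.QuasiMeasurePreserving (fun x : BinSeq => 1 - x) μ μ :=
  (Measure.measurePreserving_sub_left μ (1 : BinSeq)).quasiMeasurePreserving

/-- The real subspace `{f ∈ L₂(X) : f(1 - x) = conj f(x)}` of `L₂(X)`. -/
noncomputable def realForm (μ : Measure BinSeq) [μ.IsAddHaarMeasure] :
    Submodule ℝ (Lp ℂ 2 μ) where
  carrier := {f | (fun x => f (1 - x)) =ᵐ[μ] fun x => conj (f x)}
  zero_mem' := by
    have h := Lp.coeFn_zero ℂ 2 μ
    have h' := (BinSeq.quasiMeasurePreserving_one_sub μ).ae_eq_comp h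
    filter_upwards [h, h'] with x hx hx'
    simp only [Function.comp_apply] at hx'
    rw [hx', hx]
    simp
  add_mem' := by
    intro f g hf hg
    have h := Lp.coeFn_add f g
    have h' := (BinSeq.quasiMeasurePreserving_one_sub μ).ae_eq_comp h
    change (fun x => (f + g : Lp ℂ 2 μ) (1 - x)) =ᵐ[μ] fun x => conj ((f + g : Lp ℂ 2 μ) x)
    filter_upwards [h, h', hf, hg] with x hx hx' hfx hgx
    simp only [Function.comp_apply] at hx'
    rw [hx', hx]
    simp only [Pi.add_apply, map_add, hfx, hgx]
  smul_mem' := by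
    intro r f hf
    have h := Lp.coeFn_smul r f
    have h' := (BinSeq.quasiMeasurePreserving_one_sub μ).ae_eq_comp h
    change (fun x => (r • f : Lp ℂ 2 μ) (1 - x)) =ᵐ[μ] fun x => conj ((r • f : Lp ℂ 2 μ) x)
    filter_upwards [h, h', hf] with x hx hx' hfx
    simp only [Function.comp_apply] at hx'
    rw [hx', hx]
    simp only [Pi.smul_apply, Complex.real_smul, map_mul, Complex.conj_ofReal, hfx]

/-! ### Extending Clifford relations from an orthonormal family by continuity. -/

section Extension

variable {ι Z A : Type*} [NormedAddCommGroup Z] [InnerProductSpace ℝ Z]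
  [NormedRing A] [StarRing A] [CStarRing A] [NormedAlgebra ℝ A]

/-! The basis vectors act by weighted shifts `f ↦ u · f(· + d)` on L² of a compact group, and these
compose and take adjoints by explicit rules on the continuous weights `u`. Skewness and the Clifford
relations thus become pointwise identities between signs. For skew-hermitian operators the relations
force ‖J_v‖ = ‖v‖ by the C*-identity, so the operators on the basis extend uniquely to Z by
continuity, and then to the algebra by its universal property.

Irreducibility rests on a trivial commutant (`exists_eq_smul_one_of_commute_basisOp`). The product
of the operators of σ(z_k) and z_k is −i times multiplication by (−1)^{x_k}, so by Stone–Weierstrass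
an operator B in the commutant commutes with multiplication by every continuous function. Cancelling
the unimodular weights, it commutes with translation by every δ_k. Then B1 is translation invariant,
hence constant by Walsh orthogonality, and B is a scalar. The projection onto a closed invariant
subspace is such a B.

For the real form, let (Kf)(x) be the conjugate of f(1 − x). Reflection multiplies
(−1)^{x_1+⋯+x_{k−1}} by (−1)^{k−1}, while c_k changes sign exactly for odd k. So the weight of z_k
always changes sign, and conjugating the factor i undoes this; K therefore commutes with C(Z).
Invariant real subspaces of the fixed space complexify to invariant complex ones, which gives real
irreducibility. An equivalence with a complex representation would yield j with j² = −1 commuting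
with C(Z); its complexification is a scalar c, real because j preserves the fixed space of K, and c²
= −1 is impossible. -/

theorem norm_eq_of_star_eq_neg {a : A} (ha : star a = -a) {r : ℝ} (hr : 0 ≤ r)
    (h : a * a = algebraMap ℝ A (-r ^ 2)) [Nontrivial A] : ‖a‖ = r := by
  have h1 : ‖star a * a‖ = ‖a‖ * ‖a‖ := CStarRing.norm_star_mul_self
  rw [ha, neg_mul, h, norm_neg, norm_algebraMap, CStarRing.norm_one, mul_one, norm_neg,
    Real.norm_of_nonneg (by positivity)] at h1
  nlinarith [norm_nonneg a]

theorem Module.Basis.linear_induction {R M : Type*} [Semiring R] [AddCommMonoid M] [Module R M]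
    (b : Module.Basis ι R M) {p : M → Prop} (coe : ∀ i, p (b i)) (zero : p 0)
    (add : ∀ x y, p x → p y → p (x + y)) (smul : ∀ (r : R) (x), p x → p (r • x)) (x : M) :
    p x := by
  have hx : x ∈ Submodule.span R (Set.range b) := b.mem_span x
  induction hx using Submodule.span_induction with
  | mem x h => obtain ⟨i, rfl⟩ := h; exact coe i
  | zero => exact zero
  | add x y _ _ hx hy => exact add x y hx hy
  | smul r x _ hx => exact smul r x hx

/-- A family of skew-adjoint elements satisfying the Clifford relations of an orthonormal family
with dense span extends to the whole inner product space. -/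
theorem Orthonormal.exists_clifford_extension [CompleteSpace A] [StarModule ℝ A] [Nontrivial A]
    {v : ι → Z} (hv : Orthonormal ℝ v)
    (hd : (Submodule.span ℝ (Set.range v)).topologicalClosure = ⊤) {a : ι → A}
    (hskew : ∀ i, star (a i) = -a i) (hsq : ∀ i, a i * a i = -1)
    (hanti : ∀ i j, i ≠ j → a i * a j = -(a j * a i)) :
    ∃ J : Z →L[ℝ] A, (∀ i, J (v i) = a i) ∧ (∀ z, star (J z) = -J z) ∧
      ∀ z, J z * J z = algebraMap ℝ A (-‖z‖ ^ 2) := by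
  classical
  set S := Submodule.span ℝ (Set.range v) with hS
  set b := Module.Basis.span hv.linearIndependent with hb
  have hbv : ∀ i, ((b i : S) : Z) = v i := fun i => by
    rw [hb, Module.Basis.span_apply]
  let T : S →ₗ[ℝ] A := b.constr ℝ a
  have hT : ∀ i, T (b i) = a i := fun i => b.constr_basis ℝ a i
  have hTskew : ∀ s, star (T s) = -T s := by
    intro s
    induction s using b.linear_induction with
    | coe i => rw [hT, hskew]
    | zero => simp
    | add x y hx hy => rw [map_add, star_add, hx, hy, neg_add]
    | smul r x hx => rw [map_smul, star_smul, hx, star_trivial, smul_neg]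
  -- The polarised relation is bilinear, so it can be checked on basis pairs; the relation for
  -- squares could not.
  have hTbil : ∀ s t, T s * T t + T t * T s = algebraMap ℝ A (-2 * inner ℝ (s : Z) (t : Z)) := by
    intro s t
    induction s using b.linear_induction with
    | coe i =>
      induction t using b.linear_induction with
      | coe j =>
        rw [hT, hT, hbv, hbv, orthonormal_iff_ite.1 hv i j]
        split_ifs with h
        · subst h
          rw [hsq, mul_one, map_neg, map_ofNat]
          norm_num
        · rw [hanti i j h]
          simp
      | zero => simp
      | add x y hx hy =>
        rw [map_add, mul_add, add_mul, Submodule.coe_add, inner_add_right, mul_add, map_add,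
          ← hx, ← hy]
        abel
      | smul r x hx =>
        rw [map_smul, mul_smul_comm, smul_mul_assoc, ← smul_add, hx, Submodule.coe_smul,
          inner_smul_right, Algebra.smul_def, ← map_mul]
        congr 1
        ring
    | zero => simp
    | add x y hx hy =>
      rw [map_add, mul_add, add_mul, Submodule.coe_add, inner_add_left, mul_add, map_add,
        ← hx, ← hy]
      abel
    | smul r x hx =>
      rw [map_smul, mul_smul_comm, smul_mul_assoc, ← smul_add, hx, Submodule.coe_smul,
        inner_smul_left, Algebra.smul_def, ← map_mul]
      congr 1
      simp only [RCLike.conj_to_real]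
      ring
  have hTsq : ∀ s : S, T s * T s = algebraMap ℝ A (-‖(s : Z)‖ ^ 2) := by
    intro s
    have h := hTbil s s
    rw [real_inner_self_eq_norm_sq, ← two_smul ℝ, Algebra.smul_def] at h
    have h2 : T s * T s = algebraMap ℝ A (2⁻¹) * (algebraMap ℝ A 2 * (T s * T s)) := by
      rw [← mul_assoc, ← map_mul (algebraMap ℝ A)]; norm_num
    rw [h2, h, ← map_mul]
    congr 1
    ring
  -- Being isometric on the dense span is what allows `T` to extend by continuity.
  have hTn : ∀ s : S, ‖T s‖ = ‖(s : Z)‖ := fun s =>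
    norm_eq_of_star_eq_neg (hTskew s) (norm_nonneg _) (hTsq s)
  have hdense : DenseRange S.subtypeL := by
    have : Dense (S : Set Z) := (Submodule.dense_iff_topologicalClosure_eq_top).2 hd
    simpa [DenseRange] using this
  have hbd : ∃ C, ∀ x, ‖T x‖ ≤ C * ‖S.subtypeL x‖ := ⟨1, fun x => by simp [hTn]⟩
  let J : Z →L[ℝ] A := T.extendOfNorm S.subtypeL
  have hJ : ∀ s : S, J s = T s := fun s => T.extendOfNorm_eq hdense hbd s
  refine ⟨J, fun i => by rw [← hbv, hJ, hT], fun z => ?_, fun z => ?_⟩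
  · refine hdense.induction_on (p := fun z => star (J z) = -J z) z
      (isClosed_eq (by fun_prop) (by fun_prop)) fun s => ?_
    change star (J s) = -J s
    rw [hJ, hTskew]
  · refine hdense.induction_on (p := fun z => J z * J z = algebraMap ℝ A (-‖z‖ ^ 2)) z
      (isClosed_eq (by fun_prop) ?_) fun s => ?_
    · exact (algebraMapCLM ℝ A).continuous.comp (by fun_prop)
    · change J s * J s = algebraMap ℝ A (-‖(s : Z)‖ ^ 2)
      rw [hJ, hTsq]

end Extension

/-- The translate `x ↦ u (x + d)` of a continuous function. -/
noncomputable def ContinuousMap.translate {G : Type*} [TopologicalSpace G] [Add G] [ContinuousAdd G]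
    (d : G) (u : C(G, ℂ)) : C(G, ℂ) where
  toFun x := u (x + d)

@[simp]
theorem ContinuousMap.translate_apply {G : Type*} [TopologicalSpace G] [Add G] [ContinuousAdd G]
    (d : G) (u : C(G, ℂ)) (x : G) : u.translate d x = u (x + d) := rfl

theorem ae_comp_add_right {G : Type*} [AddGroup G] [MeasurableSpace G] [MeasurableAdd G]
    (μ : Measure G) [μ.IsAddRightInvariant] {p : G → Prop} (d : G) (h : ∀ᵐ x ∂μ, p x) : ∀ᵐ x ∂μ, p (x + d) :=
  (measurePreserving_add_right μ d).quasiMeasurePreserving.ae h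

/-! ### Calculus of weighted shifts on L² of a compact abelian group. -/

section WeightedShift

variable {G : Type*} [AddCommGroup G] [TopologicalSpace G] [IsTopologicalAddGroup G]
  [CompactSpace G] [MeasurableSpace G] [BorelSpace G] (μ : Measure G) [μ.IsAddHaarMeasure]

/-- The operator `f ↦ u · f(· + d)` on `L²(G)`, for a continuous weight `u`. -/
noncomputable def weightedShift (d : G) : C(G, ℂ) →L[ℂ] (Lp ℂ 2 μ →L[ℂ] Lp ℂ 2 μ) :=
  (ContinuousLinearMap.precomp (Lp ℂ 2 μ) (Lp.compMeasurePreservingₗᵢ ℂ (· + d)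
    (measurePreserving_add_right μ d)).toContinuousLinearMap).comp
  (((ContinuousLinearMap.mul ℂ ℂ).holderL μ ∞ 2 2).comp (ContinuousMap.toLp ∞ μ ℂ))

theorem coeFn_weightedShift (d : G) (u : C(G, ℂ)) (f : Lp ℂ 2 μ) :
    weightedShift μ d u f =ᵐ[μ] fun x => u x * f (x + d) := by
  have h1 := (ContinuousLinearMap.mul ℂ ℂ).coeFn_holder (r := 2) (ContinuousMap.toLp ∞ μ ℂ u)
    (Lp.compMeasurePreservingₗᵢ ℂ (· + d) (measurePreserving_add_right μ d) f)
  have h2 := ContinuousMap.coeFn_toLp (p := ∞) (𝕜 := ℂ) μ u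
  have h3 := Lp.coeFn_compMeasurePreserving f (measurePreserving_add_right μ d)
  refine EventuallyEq.trans h1 ?_
  filter_upwards [h2, h3] with x hx hx'
  rw [hx]
  simp only [ContinuousLinearMap.mul_apply']
  congr 1

theorem weightedShift_mul (d e : G) (u v : C(G, ℂ)) :
    weightedShift μ d u * weightedShift μ e v = weightedShift μ (d + e) (u * v.translate d) := by
  ext1 f
  apply Lp.ext
  filter_upwards [coeFn_weightedShift μ d u (weightedShift μ e v f),
    ae_comp_add_right μ d (coeFn_weightedShift μ e v f),
    coeFn_weightedShift μ (d + e) (u * v.translate d) f] with x h1 h2 h3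
  change weightedShift μ d u (weightedShift μ e v f) x = _
  rw [h1, h2, h3]
  simp [mul_assoc, add_assoc]

theorem weightedShift_zero_one : weightedShift μ (0 : G) 1 = 1 := by
  ext1 f
  apply Lp.ext
  filter_upwards [coeFn_weightedShift μ 0 1 f] with x h1
  rw [h1]
  simp

/-- Invariance of Haar measure under the substitution x ↦ x + d moves the shift to the other factor
of the inner product. -/
theorem adjoint_weightedShift (d : G) (u : C(G, ℂ)) :
    ContinuousLinearMap.adjoint (weightedShift μ d u) =
      weightedShift μ (-d) ((star u).translate (-d)) := by
  symm
  rw [ContinuousLinearMap.eq_adjoint_iff]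
  intro f g
  rw [L2.inner_def, L2.inner_def]
  rw [← (measurePreserving_add_right μ d).integral_comp
    (MeasurableEquiv.addRight d).measurableEmbedding]
  apply integral_congr_ae
  filter_upwards [coeFn_weightedShift μ d u g,
    ae_comp_add_right μ d (coeFn_weightedShift μ (-d) ((star u).translate (-d)) f)] with x h1 h2
  rw [h1, h2]
  simp only [RCLike.inner_apply, ContinuousMap.translate_apply, add_neg_cancel_right,
    ContinuousMap.star_apply, RCLike.star_def, map_mul, Complex.conj_conj]
  ring

theorem weightedShift_toLp (d : G) (u v : C(G, ℂ)) :
    weightedShift μ d u (ContinuousMap.toLp 2 μ ℂ v) =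
      ContinuousMap.toLp 2 μ ℂ (u * v.translate d) := by
  apply Lp.ext
  filter_upwards [coeFn_weightedShift μ d u (ContinuousMap.toLp 2 μ ℂ v),
    ae_comp_add_right μ d (ContinuousMap.coeFn_toLp (p := 2) (𝕜 := ℂ) μ v),
    ContinuousMap.coeFn_toLp (p := 2) (𝕜 := ℂ) μ (u * v.translate d)] with x h1 h2 h3
  rw [h1, h2, h3]
  rfl

end WeightedShift

/-! ### Signs, characters and Walsh functions. -/

theorem ZMod.two_cases (a : ZMod 2) : a = 0 ∨ a = 1 := by
  revert a
  decide

@[simp]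
theorem bitSign_zero : bitSign 0 = 1 := by simp [bitSign]

@[simp]
theorem bitSign_one : bitSign 1 = -1 := by simp [bitSign, ZMod.val_one]

theorem bitSign_add (a b : ZMod 2) : bitSign (a + b) = bitSign a * bitSign b := by
  rcases ZMod.two_cases a with rfl | rfl <;> rcases ZMod.two_cases b with rfl | rfl <;>
    simp [show (1 + 1 : ZMod 2) = 0 from rfl]

@[simp]
theorem bitSign_mul_self (a : ZMod 2) : bitSign a * bitSign a = 1 := by
  rcases ZMod.two_cases a with rfl | rfl <;> simp

@[simp]
theorem conj_bitSign (a : ZMod 2) : conj (bitSign a) = bitSign a := by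
  simp [bitSign]

theorem bitSign_injective : Function.Injective bitSign := by
  intro a b h
  rcases ZMod.two_cases a with rfl | rfl <;> rcases ZMod.two_cases b with rfl | rfl <;>
    first | rfl | (exfalso; norm_num at h)

@[simp]
theorem BinSeq.neg_eq (x : BinSeq) : -x = x := by
  ext1 k
  exact ZMod.neg_eq_self_mod_two (x k)

/-- The continuous character `x ↦ (-1)^{x_k}` of `{0,1}^ℕ`. -/
noncomputable def bitChar (k : ℕ+) : C(BinSeq, ℂ) where
  toFun x := bitSign (x k)
  continuous_toFun := (continuous_of_discreteTopology (f := bitSign)).comp (continuous_apply k)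

@[simp]
theorem bitChar_apply (k : ℕ+) (x : BinSeq) : bitChar k x = bitSign (x k) := rfl

theorem bitChar_mul_self (k : ℕ+) : bitChar k * bitChar k = 1 := by
  ext x; simp

/-- The Walsh function `x ↦ ∏_{k ∈ S} (-1)^{x_k}`. -/
noncomputable def walsh (S : Finset ℕ+) : C(BinSeq, ℂ) := ∏ k ∈ S, bitChar k

theorem bitChar_mul_walsh (k : ℕ+) (S : Finset ℕ+) : ∃ S', bitChar k * walsh S = walsh S' := by
  by_cases h : k ∈ S
  · refine ⟨S.erase k, ?_⟩
    rw [walsh, ← Finset.mul_prod_erase S _ h, ← mul_assoc, bitChar_mul_self, one_mul, walsh]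
  · exact ⟨insert k S, by rw [walsh, walsh, Finset.prod_insert h]⟩

theorem adjoin_bitChar_eq_span_walsh :
    Subalgebra.toSubmodule (Algebra.adjoin ℂ (Set.range bitChar)) =
      Submodule.span ℂ (Set.range walsh) := by
  apply le_antisymm
  · rw [Algebra.adjoin_eq_span]
    apply Submodule.span_mono
    intro f hf
    induction hf using Submonoid.closure_induction_left with
    | one => exact ⟨∅, by simp [walsh]⟩
    | mul_left x hx y _ hy =>
      obtain ⟨k, rfl⟩ := hx
      obtain ⟨S, rfl⟩ := hy
      obtain ⟨S', h⟩ := bitChar_mul_walsh k S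
      exact ⟨S', h.symm⟩
  · rw [Submodule.span_le]
    rintro _ ⟨S, rfl⟩
    exact Subalgebra.prod_mem _ fun k _ => Algebra.subset_adjoin ⟨k, rfl⟩

/-- Stone–Weierstrass: the characters are real-valued, so the algebra they generate is star-closed,
and they separate points. -/
theorem span_walsh_topologicalClosure :
    (Submodule.span ℂ (Set.range walsh)).topologicalClosure = ⊤ := by
  have hstar : star (Set.range bitChar) = Set.range bitChar := by
    have : ∀ k, star (bitChar k) = bitChar k := fun k => by ext x; simp
    ext f
    constructor
    · rintro ⟨k, hk⟩
      exact ⟨k, by rw [← this, hk, star_star]⟩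
    · rintro ⟨k, rfl⟩
      exact ⟨k, (this k).symm⟩
  have h := ContinuousMap.starSubalgebra_topologicalClosure_eq_top_of_separatesPoints
    (StarAlgebra.adjoin ℂ (Set.range bitChar)) (by
      intro x y hxy
      obtain ⟨k, hk⟩ := Function.ne_iff.1 hxy
      exact ⟨_, ⟨bitChar k, StarAlgebra.subset_adjoin ℂ _ ⟨k, rfl⟩, rfl⟩,
        fun h => hk (bitSign_injective h)⟩)
  rw [← adjoin_bitChar_eq_span_walsh]
  have h2 : (StarAlgebra.adjoin ℂ (Set.range bitChar)).toSubalgebra =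
      Algebra.adjoin ℂ (Set.range bitChar) := by
    rw [StarAlgebra.adjoin_toSubalgebra, hstar, Set.union_self]
  rw [← h2]
  apply SetLike.coe_injective
  have h3 := congrArg (fun A : StarSubalgebra ℂ C(BinSeq, ℂ) => (A : Set C(BinSeq, ℂ))) h
  simpa using h3

theorem walsh_mem_induction {p : C(BinSeq, ℂ) → Prop} (hcl : IsClosed {u | p u})
    (hw : ∀ S, p (walsh S)) (zero : p 0) (add : ∀ u v, p u → p v → p (u + v))
    (smul : ∀ (c : ℂ) u, p u → p (c • u)) (u : C(BinSeq, ℂ)) : p u := by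
  have hu : u ∈ (Submodule.span ℂ (Set.range walsh)).topologicalClosure := by
    rw [span_walsh_topologicalClosure]; trivial
  refine closure_minimal (fun v hv => ?_) hcl hu
  change p v
  induction hv using Submodule.span_induction with
  | mem x h => obtain ⟨S, rfl⟩ := h; exact hw S
  | zero => exact zero
  | add x y _ _ hx hy => exact add x y hx hy
  | smul r x _ hx => exact smul r x hx

theorem bitSign_add_delta (x : BinSeq) (j k : ℕ+) :
    bitSign ((x + BinSeq.delta j) k) = if k = j then -bitSign (x k) else bitSign (x k) := by
  rw [Pi.add_apply, bitSign_add, BinSeq.delta]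
  split_ifs with h
  · subst h; simp
  · simp [h]

theorem walsh_translate_delta {S : Finset ℕ+} {k : ℕ+} (hk : k ∈ S) :
    (walsh S).translate (BinSeq.delta k) = -walsh S := by
  ext x
  simp only [walsh, ContinuousMap.translate_apply, ContinuousMap.coe_prod, Finset.prod_apply,
    ContinuousMap.neg_apply, bitChar_apply, bitSign_add_delta]
  rw [← Finset.mul_prod_erase S _ hk, ← Finset.mul_prod_erase S (fun i => bitSign (x i)) hk,
    if_pos rfl, neg_mul]
  congr 2
  exact Finset.prod_congr rfl fun i hi => if_neg (Finset.ne_of_mem_erase hi)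

/-! ### The commutant of characters and shifts. -/

section Commutant

variable (μ : Measure BinSeq) [μ.IsAddHaarMeasure]

theorem toLp_denseRange_binSeq : DenseRange (ContinuousMap.toLp (α := BinSeq) (E := ℂ) 2 μ ℂ) :=
  ContinuousMap.toLp_denseRange ℂ μ ℂ (by norm_num)

/-- A square-integrable function on `{0,1}^ℕ` that is invariant under all translations by `δ_k` is
constant. -/
theorem exists_eq_smul_one_of_invariant (g : Lp ℂ 2 μ)
    (hg : ∀ k, weightedShift μ (BinSeq.delta k) 1 g = g) :
    ∃ c : ℂ, g = c • ContinuousMap.toLp 2 μ ℂ (1 : C(BinSeq, ℂ)) := by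
  set e : Lp ℂ 2 μ := ContinuousMap.toLp 2 μ ℂ (1 : C(BinSeq, ℂ)) with he
  have hinv : ∀ (f : Lp ℂ 2 μ), (∀ k, weightedShift μ (BinSeq.delta k) 1 f = f) →
      ∀ S : Finset ℕ+, S.Nonempty → inner ℂ (ContinuousMap.toLp 2 μ ℂ (walsh S)) f = 0 := by
    rintro f hf S ⟨k, hk⟩
    have h : inner ℂ (ContinuousMap.toLp 2 μ ℂ (walsh S)) f =
        -inner ℂ (ContinuousMap.toLp 2 μ ℂ (walsh S)) f := by
      conv_lhs => rw [← hf k]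
      -- The adjoint shift is again by δ_k, as the group has exponent 2, and for k in `S` the Walsh
      -- function is an eigenvector with eigenvalue −1.
      rw [← ContinuousLinearMap.adjoint_inner_left, adjoint_weightedShift, weightedShift_toLp,
        BinSeq.neg_eq, walsh_translate_delta hk, ← inner_neg_left, ← map_neg]
      congr 3
      ext x
      simp
    exact self_eq_neg.1 h
  have he1 : ∀ k, weightedShift μ (BinSeq.delta k) 1 e = e := fun k => by
    rw [he, weightedShift_toLp]
    congr 1
    ext; simp
  -- The coefficient of the orthogonal projection of `g` onto the constants.
  refine ⟨inner ℂ e g / inner ℂ e e, ?_⟩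
  rw [← sub_eq_zero]
  set c : ℂ := inner ℂ e g / inner ℂ e e with hc
  have hperp : ∀ u : C(BinSeq, ℂ), inner ℂ (ContinuousMap.toLp 2 μ ℂ u) (g - c • e) = 0 := by
    apply walsh_mem_induction
    · exact isClosed_eq (by fun_prop) continuous_const
    · intro S
      rcases S.eq_empty_or_nonempty with rfl | hS
      · rw [show walsh ∅ = 1 by simp [walsh], ← he, inner_sub_right, inner_smul_right, hc]
        by_cases h0 : e = 0
        · simp [h0]
        · rw [div_mul_cancel₀ _ (inner_self_ne_zero.2 h0), sub_self]
      · refine hinv _ (fun k => ?_) S hS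
        rw [map_sub, map_smul, hg, he1]
    · simp
    · intro u v hu hv
      rw [map_add, inner_add_left, hu, hv, add_zero]
    · intro c u hu
      rw [map_smul, inner_smul_left, hu, mul_zero]
  have hperp' : ∀ f : Lp ℂ 2 μ, inner ℂ f (g - c • e) = 0 := fun f =>
    (toLp_denseRange_binSeq μ).induction_on (p := fun f => inner ℂ f (g - c • e) = 0) f
      (isClosed_eq (by fun_prop) continuous_const) hperp
  exact inner_self_eq_zero.1 (hperp' _)

/-- Multiplications by the characters `(-1)^{x_k}` together with unimodular weighted shifts by the
`δ_k` have trivial commutant. -/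
theorem exists_eq_smul_one_of_commute {B : Lp ℂ 2 μ →L[ℂ] Lp ℂ 2 μ}
    (hM : ∀ k, Commute B (weightedShift μ 0 (bitChar k))) {w : ℕ+ → C(BinSeq, ℂ)}
    (hw : ∀ k, star (w k) * w k = 1)
    (hT : ∀ k, Commute B (weightedShift μ (BinSeq.delta k) (w k))) :
    ∃ c : ℂ, B = c • 1 := by
  have hmul : ∀ u : C(BinSeq, ℂ), Commute B (weightedShift μ 0 u) := by
    apply walsh_mem_induction
    -- `weightedShift μ 0` is continuous in the weight, so commuting survives uniform limits.
    · exact isClosed_eq (by fun_prop) (by fun_prop)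
    · intro S
      induction S using Finset.induction_on with
      | empty =>
        rw [show walsh ∅ = 1 by simp [walsh], weightedShift_zero_one]
        exact Commute.one_right B
      | insert k S hk ih =>
        have : weightedShift μ 0 (walsh (insert k S)) =
            weightedShift μ 0 (bitChar k) * weightedShift μ 0 (walsh S) := by
          rw [weightedShift_mul, walsh, Finset.prod_insert hk, add_zero]
          congr 2
          ext x; simp [walsh]
        rw [this]
        exact (hM k).mul_right ih
    · rw [map_zero]; exact Commute.zero_right B
    · intro u v hu hv
      rw [map_add]; exact hu.add_right hv
    · intro c u hu
      rw [map_smul]; exact hu.smul_right c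
  have hshift : ∀ k, Commute B (weightedShift μ (BinSeq.delta k) 1) := fun k => by
    have : weightedShift μ (BinSeq.delta k) 1 =
        weightedShift μ 0 (star (w k)) * weightedShift μ (BinSeq.delta k) (w k) := by
      rw [weightedShift_mul, zero_add, ← hw k]
      congr 2
      ext x; simp
    rw [this]
    exact (hmul _).mul_right (hT k)
  set e : Lp ℂ 2 μ := ContinuousMap.toLp 2 μ ℂ (1 : C(BinSeq, ℂ)) with he
  have happ : ∀ {A : Lp ℂ 2 μ →L[ℂ] Lp ℂ 2 μ}, Commute B A → ∀ f, B (A f) = A (B f) :=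
    fun h f => DFunLike.congr_fun h f
  obtain ⟨c, hc⟩ := exists_eq_smul_one_of_invariant μ (B e) fun k => by
    rw [← happ (hshift k), he, weightedShift_toLp]
    congr 2
    ext; simp
  refine ⟨c, ?_⟩
  ext1 f
  refine (toLp_denseRange_binSeq μ).induction_on
    (p := fun f => B f = (c • (1 : Lp ℂ 2 μ →L[ℂ] Lp ℂ 2 μ)) f) f
    (isClosed_eq (by fun_prop) (by fun_prop)) fun u => ?_
  -- The constant function is cyclic for multiplications, so `B` is determined by `B e`.
  have hu : ContinuousMap.toLp 2 μ ℂ u = weightedShift μ 0 u e := by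
    rw [he, weightedShift_toLp]
    congr 1
    ext; simp
  rw [hu, happ (hmul u), hc, map_smul]
  rfl

end Commutant

/-! ### Sign identities for the coefficients and weights. -/

/-- The symmetric relation pairing `4ℓ + 1` with `4ℓ + 3`. -/
def SplitPartner (k l : ℕ+) : Prop :=
  ((k : ℕ) % 4 = 1 ∧ (l : ℕ) = k + 2) ∨ ((l : ℕ) % 4 = 1 ∧ (k : ℕ) = l + 2)

theorem splitPartner_comm (k l : ℕ+) : SplitPartner k l ↔ SplitPartner l k :=
  or_comm

theorem not_splitPartner_self (k : ℕ+) : ¬ SplitPartner k k := by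
  unfold SplitPartner
  omega

theorem PNat.coe_sub_two {k : ℕ+} (hk : (k : ℕ) % 4 = 3) : ((k - 2 : ℕ+) : ℕ) = k - 2 := by
  have h : (2 : ℕ+) < k := by
    rw [← PNat.coe_lt_coe]
    change 2 < (k : ℕ)
    omega
  rw [PNat.sub_coe, if_pos h]
  rfl

open Classical in
/-- The sign `-1` if `p` holds and `1` otherwise. -/
noncomputable def propSign (p : Prop) : ℂ := if p then -1 else 1

theorem propSign_of {p : Prop} (h : p) : propSign p = -1 := if_pos h

theorem propSign_of_not {p : Prop} (h : ¬ p) : propSign p = 1 := if_neg h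

theorem bitSign_add_delta' (x : BinSeq) (j k : ℕ+) :
    bitSign ((x + BinSeq.delta j) k) = propSign (k = j) * bitSign (x k) := by
  rw [bitSign_add_delta]
  split_ifs with h
  · rw [propSign_of h, neg_one_mul]
  · rw [propSign_of_not h, one_mul]

/-- Each c_k depends on at most one coordinate, that of the partner of k. Symmetry of the pairing
then gives the cocycle identity, and its irreflexivity the conjugation identity. -/
theorem splitCoeff_add_delta (k j : ℕ+) (x : BinSeq) :
    splitCoeff k (x + BinSeq.delta j) = propSign (SplitPartner k j) * splitCoeff k x := by
  have h2 : ((2 : ℕ+) : ℕ) = 2 := rfl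
  unfold splitCoeff
  split_ifs with h1 h3
  · rw [bitSign_add_delta']
    congr 2
    rw [← PNat.coe_inj, PNat.add_coe, h2, SplitPartner]
    apply propext
    omega
  · rw [bitSign_add_delta']
    congr 2
    rw [← PNat.coe_inj, PNat.coe_sub_two h3, SplitPartner]
    apply propext
    omega
  · rw [propSign_of_not, one_mul]
    unfold SplitPartner
    omega

theorem continuous_splitCoeff (k : ℕ+) : Continuous (splitCoeff k) := by
  unfold splitCoeff
  split_ifs
  · exact (bitChar _).continuous
  · exact (bitChar _).continuous
  · exact continuous_const

theorem splitCoeff_mul_self (k : ℕ+) (x : BinSeq) : splitCoeff k x * splitCoeff k x = 1 := by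
  unfold splitCoeff
  split_ifs <;> simp

theorem conj_splitCoeff (k : ℕ+) (x : BinSeq) : conj (splitCoeff k x) = splitCoeff k x := by
  unfold splitCoeff
  split_ifs <;> simp

theorem isGWCoeff_splitCoeff : IsGWCoeff splitCoeff where
  measurable k := (continuous_splitCoeff k).measurable
  norm_eq_one k x := by
    have h := congrArg norm (splitCoeff_mul_self k x)
    rw [norm_mul, norm_one] at h
    nlinarith [norm_nonneg (splitCoeff k x)]
  conj_eq k x := by
    rw [conj_splitCoeff, splitCoeff_add_delta, propSign_of_not (not_splitPartner_self k), one_mul]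
  cocycle k l x := by
    rw [splitCoeff_add_delta, splitCoeff_add_delta, splitPartner_comm k l]
    ring

theorem bitSign_one_sub (a : ZMod 2) : bitSign (1 - a) = -bitSign a := by
  rcases ZMod.two_cases a with rfl | rfl <;> simp

theorem splitCoeff_one_sub (k : ℕ+) (x : BinSeq) :
    splitCoeff k (1 - x) = propSign ((k : ℕ) % 2 = 1) * splitCoeff k x := by
  unfold splitCoeff
  split_ifs with h1 h3
  · rw [Pi.sub_apply, Pi.one_apply, bitSign_one_sub, propSign_of (by omega), neg_one_mul]
  · rw [Pi.sub_apply, Pi.one_apply, bitSign_one_sub, propSign_of (by omega), neg_one_mul]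
  · rw [propSign_of_not (by omega), one_mul]

/-- The sign `(-1)^{x₁ + ⋯ + x_{k-1} + 1}`. -/
noncomputable def parity (k : ℕ+) (x : BinSeq) : ℂ :=
  (-1) ^ ((∑ j ∈ Finset.Iio k, (x j).val) + 1)

theorem parity_eq (k : ℕ+) (x : BinSeq) : parity k x = -walsh (Finset.Iio k) x := by
  simp [parity, walsh, pow_succ, ← Finset.prod_pow_eq_pow_sum, bitSign]

theorem parity_add_delta (k j : ℕ+) (x : BinSeq) :
    parity k (x + BinSeq.delta j) = propSign (j < k) * parity k x := by
  rw [parity_eq, parity_eq]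
  by_cases h : j < k
  · have := DFunLike.congr_fun (walsh_translate_delta (Finset.mem_Iio.2 h)) x
    rw [ContinuousMap.translate_apply] at this
    rw [this, propSign_of h]
    simp
  · rw [propSign_of_not h, one_mul]
    simp only [walsh, ContinuousMap.coe_prod, Finset.prod_apply, bitChar_apply]
    congr 1
    refine Finset.prod_congr rfl fun i hi => ?_
    rw [bitSign_add_delta, if_neg]
    rintro rfl
    exact h (Finset.mem_Iio.1 hi)

theorem parity_mul_self (k : ℕ+) (x : BinSeq) : parity k x * parity k x = 1 := by
  rw [parity, ← mul_pow]
  simp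

theorem conj_parity (k : ℕ+) (x : BinSeq) : conj (parity k x) = parity k x := by
  simp [parity]

theorem parity_one_sub (k : ℕ+) (x : BinSeq) :
    parity k (1 - x) = propSign ((k : ℕ) % 2 = 0) * parity k x := by
  rw [parity_eq, parity_eq]
  simp only [walsh, ContinuousMap.coe_prod, Finset.prod_apply, bitChar_apply, Pi.sub_apply,
    Pi.one_apply, bitSign_one_sub]
  rw [Finset.prod_neg, mul_neg, ← Finset.Ico_bot, PNat.card_Ico, PNat.bot_eq_one, PNat.one_coe]
  congr 2
  have hk := k.pos
  rcases Nat.even_or_odd ((k : ℕ) - 1) with h | h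
  · rw [h.neg_one_pow, propSign_of_not]
    rw [Nat.even_iff] at h; omega
  · rw [h.neg_one_pow, propSign_of]
    rw [Nat.odd_iff] at h; omega

/-- The weight of the weighted shift by which `z_k` acts. -/
noncomputable def gwWeight (k : ℕ+) : C(BinSeq, ℂ) where
  toFun x := parity k x * Complex.I * splitCoeff k x
  continuous_toFun := by
    have h : Continuous (parity k) := by
      rw [funext (parity_eq k)]
      fun_prop
    have := continuous_splitCoeff k
    fun_prop

theorem gwWeight_apply (k : ℕ+) (x : BinSeq) :
    gwWeight k x = parity k x * Complex.I * splitCoeff k x := rfl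

theorem gwWeight_add_delta (k j : ℕ+) (x : BinSeq) :
    gwWeight k (x + BinSeq.delta j) =
      propSign (j < k) * propSign (SplitPartner k j) * gwWeight k x := by
  rw [gwWeight_apply, gwWeight_apply, parity_add_delta, splitCoeff_add_delta]
  ring

theorem gwWeight_mul_self (k : ℕ+) (x : BinSeq) : gwWeight k x * gwWeight k x = -1 := by
  rw [gwWeight_apply]
  linear_combination (splitCoeff k x * splitCoeff k x) * (parity k x * parity k x) *
    Complex.I_mul_I - splitCoeff_mul_self k x * (parity k x * parity k x) - parity_mul_self k x

theorem conj_gwWeight (k : ℕ+) (x : BinSeq) : conj (gwWeight k x) = -gwWeight k x := by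
  rw [gwWeight_apply, map_mul, map_mul, conj_parity, conj_splitCoeff, Complex.conj_I]
  ring

/-- The parity factor flips for even k and c_k for odd k, so exactly one of them flips. This is
where the choice of the c_k matters. -/
theorem gwWeight_one_sub (k : ℕ+) (x : BinSeq) : gwWeight k (1 - x) = -gwWeight k x := by
  rw [gwWeight_apply, gwWeight_apply, parity_one_sub, splitCoeff_one_sub]
  rcases Nat.mod_two_eq_zero_or_one k with h | h
  · rw [propSign_of h, propSign_of_not (by omega)]; ring
  · rw [propSign_of h, propSign_of_not (by omega)]; ring

/-- The weights of the weighted shifts by which the vectors `z_k` and `σ(z_k)` act. -/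
noncomputable def basisWeight : ℕ+ ⊕ ℕ+ → C(BinSeq, ℂ)
  | .inl k => gwWeight k
  | .inr k => Complex.I • (bitChar k * gwWeight k)

/-- The index `k` of the basis vector `z_k` or `σ(z_k)`. -/
def basisIndex : ℕ+ ⊕ ℕ+ → ℕ+ := Sum.elim id id

theorem propSign_lt_comm {j k : ℕ+} (h : j ≠ k) : propSign (j < k) = -propSign (k < j) := by
  rcases h.lt_or_gt with h | h
  · rw [propSign_of h, propSign_of_not h.not_gt]
  · rw [propSign_of h, propSign_of_not h.not_gt, neg_neg]

/-- For distinct indices j and k, exactly one of j < k and k < j holds, which produces the minus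
sign, while the partner signs agree on both sides. For z_k against σ(z_k) the minus sign comes from
(−1)^{x_k}, which the shift by δ_k flips. -/
theorem basisWeight_anticomm {s t : ℕ+ ⊕ ℕ+} (hst : s ≠ t) (x : BinSeq) :
    basisWeight s x * basisWeight t (x + BinSeq.delta (basisIndex s)) =
      -(basisWeight t x * basisWeight s (x + BinSeq.delta (basisIndex t))) := by
  by_cases h : basisIndex s = basisIndex t
  · rcases s with j | j <;> rcases t with k | k <;> simp only [basisIndex, Sum.elim_inl,
      Sum.elim_inr, id] at h <;> subst h
    · exact absurd rfl hst
    · simp only [basisIndex, basisWeight, Sum.elim_inl, Sum.elim_inr, id, ContinuousMap.smul_apply,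
        ContinuousMap.mul_apply, bitChar_apply, bitSign_add_delta', gwWeight_add_delta,
        propSign_of, smul_eq_mul]
      ring
    · simp only [basisIndex, basisWeight, Sum.elim_inl, Sum.elim_inr, id, ContinuousMap.smul_apply,
        ContinuousMap.mul_apply, bitChar_apply, bitSign_add_delta', gwWeight_add_delta,
        propSign_of, smul_eq_mul]
      ring
    · exact absurd rfl hst
  · rcases s with j | j <;> rcases t with k | k <;> simp only [basisIndex, Sum.elim_inl,
      Sum.elim_inr, id] at h <;>
    simp only [basisIndex, basisWeight, Sum.elim_inl, Sum.elim_inr, id, ContinuousMap.smul_apply,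
        ContinuousMap.mul_apply, bitChar_apply, bitSign_add_delta', gwWeight_add_delta,
        propSign_of_not h, propSign_of_not (Ne.symm h), smul_eq_mul, splitPartner_comm k j,
        propSign_lt_comm h] <;>
    ring

theorem basisWeight_mul_self (t : ℕ+ ⊕ ℕ+) (x : BinSeq) :
    basisWeight t x * basisWeight t (x + BinSeq.delta (basisIndex t)) = -1 := by
  rcases t with k | k <;> simp only [basisIndex, basisWeight, Sum.elim_inl, Sum.elim_inr, id,
    ContinuousMap.smul_apply, ContinuousMap.mul_apply, bitChar_apply, bitSign_add_delta',
    gwWeight_add_delta, propSign_of, propSign_of_not (lt_irrefl k), smul_eq_mul,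
    propSign_of_not (not_splitPartner_self k), one_mul, gwWeight_mul_self]
  linear_combination -bitSign (x k) * bitSign (x k) * gwWeight k x * gwWeight k x *
    Complex.I_mul_I + gwWeight k x * gwWeight k x * bitSign_mul_self (x k) + gwWeight_mul_self k x

theorem conj_basisWeight_add_delta (t : ℕ+ ⊕ ℕ+) (x : BinSeq) :
    conj (basisWeight t (x + BinSeq.delta (basisIndex t))) = -basisWeight t x := by
  rcases t with k | k <;> simp only [basisIndex, basisWeight, Sum.elim_inl, Sum.elim_inr, id,
    ContinuousMap.smul_apply, ContinuousMap.mul_apply, bitChar_apply, bitSign_add_delta',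
    gwWeight_add_delta, propSign_of, propSign_of_not (lt_irrefl k), smul_eq_mul,
    propSign_of_not (not_splitPartner_self k), one_mul, conj_gwWeight, map_mul, conj_bitSign,
    Complex.conj_I, map_neg, map_one]
  ring

theorem conj_basisWeight_one_sub (t : ℕ+ ⊕ ℕ+) (x : BinSeq) :
    conj (basisWeight t (1 - x)) = basisWeight t x := by
  rcases t with k | k <;> simp only [basisWeight, ContinuousMap.smul_apply,
    ContinuousMap.mul_apply, bitChar_apply, Pi.sub_apply, Pi.one_apply, bitSign_one_sub,
    gwWeight_one_sub, smul_eq_mul, conj_gwWeight, map_mul, conj_bitSign, Complex.conj_I, map_neg,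
    neg_neg]
  ring

/-! ### The basis operators and the representation they determine. -/

section Representation

variable (μ : Measure BinSeq) [μ.IsAddHaarMeasure]

/-- The operators by which the vectors `z_k` and `σ(z_k)` act. -/
noncomputable def basisOp (t : ℕ+ ⊕ ℕ+) : Lp ℂ 2 μ →L[ℂ] Lp ℂ 2 μ :=
  weightedShift μ (BinSeq.delta (basisIndex t)) (basisWeight t)

theorem BinSeq.add_self_eq (x : BinSeq) : x + x = 0 := by
  nth_rewrite 2 [← BinSeq.neg_eq x]
  exact add_neg_cancel x

theorem star_basisOp (t : ℕ+ ⊕ ℕ+) : star (basisOp μ t) = -basisOp μ t := by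
  rw [ContinuousLinearMap.star_eq_adjoint, basisOp, adjoint_weightedShift, BinSeq.neg_eq, ← map_neg]
  congr 1
  ext x
  exact conj_basisWeight_add_delta t x

theorem basisOp_mul_self (t : ℕ+ ⊕ ℕ+) : basisOp μ t * basisOp μ t = -1 := by
  rw [basisOp, weightedShift_mul, BinSeq.add_self_eq, ← weightedShift_zero_one μ, ← map_neg]
  congr 1
  ext x
  exact basisWeight_mul_self t x

theorem basisOp_anticomm {s t : ℕ+ ⊕ ℕ+} (h : s ≠ t) :
    basisOp μ s * basisOp μ t = -(basisOp μ t * basisOp μ s) := by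
  rw [basisOp, basisOp, weightedShift_mul, weightedShift_mul, add_comm (BinSeq.delta (basisIndex t)),
    ← map_neg]
  congr 1
  ext x
  exact basisWeight_anticomm h x

/-- The two shifts by δ_k cancel, so the algebra contains multiplication by each character. -/
theorem basisOp_inr_mul_inl (k : ℕ+) :
    basisOp μ (.inr k) * basisOp μ (.inl k) = -Complex.I • weightedShift μ 0 (bitChar k) := by
  rw [basisOp, basisOp, weightedShift_mul, ← map_smul]
  change weightedShift μ (BinSeq.delta k + BinSeq.delta k) _ = _
  rw [BinSeq.add_self_eq]
  congr 1
  ext x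
  have := basisWeight_mul_self (.inl k) x
  simp only [basisWeight, basisIndex, Sum.elim_inl, Sum.elim_inr, id, ContinuousMap.mul_apply,
    ContinuousMap.smul_apply, ContinuousMap.translate_apply, smul_eq_mul, bitChar_apply] at this ⊢
  linear_combination Complex.I * bitSign (x k) * this

theorem exists_eq_smul_one_of_commute_basisOp {B : Lp ℂ 2 μ →L[ℂ] Lp ℂ 2 μ}
    (hB : ∀ t, Commute B (basisOp μ t)) : ∃ c : ℂ, B = c • 1 := by
  refine exists_eq_smul_one_of_commute μ (fun k => ?_) (w := gwWeight) (fun k => ?_)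
    fun k => hB (.inl k)
  · have h := ((hB (.inr k)).mul_right (hB (.inl k))).smul_right Complex.I
    rwa [basisOp_inr_mul_inl, neg_smul, smul_neg, smul_smul, Complex.I_mul_I, neg_one_smul,
      neg_neg] at h
  · ext x
    change conj (gwWeight k x) * gwWeight k x = 1
    rw [conj_gwWeight, neg_mul, gwWeight_mul_self, neg_neg]

theorem gwFormula_ae_eq (k : ℕ+) (f : Lp ℂ 2 μ) :
    gwFormula μ splitCoeff k f =ᵐ[μ] basisOp μ (.inl k) f := by
  have h1 := Measure.rnDeriv_self μ
  filter_upwards [h1, coeFn_weightedShift μ (BinSeq.delta k) (gwWeight k) f] with x hx h2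
  rw [gwFormula, (measurePreserving_add_right μ (BinSeq.delta k)).map_eq, hx]
  refine Eq.trans ?_ h2.symm
  simp [gwWeight_apply, parity]

theorem bitSign_mul_I_mul_ae_eq (k : ℕ+) (f : Lp ℂ 2 μ) :
    (fun x => bitSign (x k) * Complex.I * basisOp μ (.inl k) f x) =ᵐ[μ]
      basisOp μ (.inr k) f := by
  filter_upwards [coeFn_weightedShift μ (BinSeq.delta k) (gwWeight k) f,
    coeFn_weightedShift μ (BinSeq.delta k) (basisWeight (.inr k)) f] with x h1 h2
  refine Eq.trans ?_ h2.symm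
  change bitSign (x k) * Complex.I * weightedShift μ (BinSeq.delta k) (gwWeight k) f x = _
  rw [h1]
  simp only [basisWeight, ContinuousMap.smul_apply, ContinuousMap.mul_apply, bitChar_apply,
    smul_eq_mul]
  ring

instance : Nontrivial (Lp ℂ 2 μ) := by
  refine ⟨⟨ContinuousMap.toLp 2 μ ℂ (1 : C(BinSeq, ℂ)), 0, fun h => ?_⟩⟩
  have h1 := ContinuousMap.coeFn_toLp (p := 2) (𝕜 := ℂ) μ (1 : C(BinSeq, ℂ))
  rw [h] at h1
  obtain ⟨x, hx, hx'⟩ := (h1.and (Lp.coeFn_zero ℂ 2 μ)).exists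
  rw [hx'] at hx
  simp at hx

variable {Z : Type*} [NormedAddCommGroup Z] [InnerProductSpace ℝ Z]

theorem negNormSq_apply (z : Z) : negNormSq Z z = -‖z‖ ^ 2 := by
  simp [negNormSq]

section

variable {σ : Z →ₗᵢ[ℝ] Z} {z : ℕ+ → Z}

/-- The real basis `z_k`, `σ(z_k)`. -/
def realBasis (σ : Z →ₗᵢ[ℝ] Z) (z : ℕ+ → Z) : ℕ+ ⊕ ℕ+ → Z := Sum.elim z (fun k => σ (z k))

/-- Elements of L² that agree almost everywhere are equal, and the Radon–Nikodym factor is 1 almost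
everywhere, so the pointwise formulas amount to operator identities. -/
theorem isGWRep_splitCoeff_iff (ρ : CplxCl Z →ₐ[ℂ] (Lp ℂ 2 μ →L[ℂ] Lp ℂ 2 μ)) :
    IsGWRep σ z μ splitCoeff ρ ↔
      IsSkewRep ρ ∧ ∀ t, ρ (1 ⊗ₜ[ℝ] clGen (realBasis σ z t)) = basisOp μ t := by
  constructor
  · intro h
    have hl : ∀ k, ρ (1 ⊗ₜ[ℝ] clGen (z k)) = basisOp μ (.inl k) := fun k => by
      ext1 f
      exact Lp.ext ((h.apply_basis k f).trans (gwFormula_ae_eq μ k f))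
    refine ⟨h.skew, ?_⟩
    rintro (k | k)
    · exact hl k
    · ext1 f
      refine Lp.ext ((h.apply_sigma_basis k f).trans ?_)
      rw [hl]
      exact bitSign_mul_I_mul_ae_eq μ k f
  · rintro ⟨hs, h⟩
    have hl : ∀ k, ρ (1 ⊗ₜ[ℝ] clGen (z k)) = basisOp μ (.inl k) := fun k => h (.inl k)
    have hr : ∀ k, ρ (1 ⊗ₜ[ℝ] clGen (σ (z k))) = basisOp μ (.inr k) := fun k => h (.inr k)
    refine ⟨hs, fun k f => ?_, fun k f => ?_⟩
    · rw [hl]; exact (gwFormula_ae_eq μ k f).symm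
    · rw [hl, hr]; exact (bitSign_mul_I_mul_ae_eq μ k f).symm

end

/-- The action of the generators under a representation of the complexified Clifford algebra. -/
noncomputable def genAction {H : Type*} [NormedAddCommGroup H] [InnerProductSpace ℂ H]
    (ρ : CplxCl Z →ₐ[ℂ] (H →L[ℂ] H)) : Z →ₗ[ℝ] (H →L[ℂ] H) :=
  ((AlgHom.liftEquiv ℝ ℂ (RealCl Z) (H →L[ℂ] H)).symm ρ).toLinearMap.comp
    (CliffordAlgebra.ι (negNormSq Z))

/-- Skewness makes the generators act continuously in `v`, which is why values on a basis with
merely dense span determine the representation. -/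
theorem IsSkewRep.norm_genAction {H : Type*} [NormedAddCommGroup H] [InnerProductSpace ℂ H]
    [CompleteSpace H] [Nontrivial H] {ρ : CplxCl Z →ₐ[ℂ] (H →L[ℂ] H)} (hρ : IsSkewRep ρ) (v : Z) :
    ‖genAction ρ v‖ = ‖v‖ := by
  refine norm_eq_of_star_eq_neg (hρ v) (norm_nonneg v) ?_
  change ρ (1 ⊗ₜ[ℝ] clGen v) * ρ (1 ⊗ₜ[ℝ] clGen v) = _
  rw [← map_mul, Algebra.TensorProduct.tmul_mul_tmul, one_mul, clGen,
    CliffordAlgebra.ι_sq_scalar, negNormSq_apply, Algebra.algebraMap_eq_smul_one,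
    TensorProduct.tmul_smul, Algebra.algebraMap_eq_smul_one]
  rw [← Algebra.TensorProduct.one_def, ← algebraMap_smul ℂ, map_smul, map_one, algebraMap_smul]

theorem IsSkewRep.continuous_genAction {H : Type*} [NormedAddCommGroup H] [InnerProductSpace ℂ H]
    [CompleteSpace H] [Nontrivial H] {ρ : CplxCl Z →ₐ[ℂ] (H →L[ℂ] H)} (hρ : IsSkewRep ρ) :
    Continuous (genAction ρ) :=
  AddMonoidHomClass.continuous_of_bound (genAction ρ) 1 fun v => by
    rw [hρ.norm_genAction, one_mul]

/-- A closed condition on vectors that holds on a basis and is stable under linear combinations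
holds everywhere. -/
theorem dense_span_induction {ι : Type*} {v : ι → Z}
    (hd : (Submodule.span ℝ (Set.range v)).topologicalClosure = ⊤) {p : Z → Prop}
    (hcl : IsClosed {x | p x}) (basis : ∀ i, p (v i)) (zero : p 0)
    (add : ∀ x y, p x → p y → p (x + y)) (smul : ∀ (r : ℝ) (x), p x → p (r • x)) (x : Z) : p x := by
  have hx : x ∈ (Submodule.span ℝ (Set.range v)).topologicalClosure := by rw [hd]; trivial
  refine closure_minimal (fun y hy => ?_) hcl hx
  change p y
  induction hy using Submodule.span_induction with
  | mem x h => obtain ⟨i, rfl⟩ := h; exact basis i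
  | zero => exact zero
  | add x y _ _ hx hy => exact add x y hx hy
  | smul r x _ hx => exact smul r x hx

theorem IsSkewRep.ext_of_basis {H : Type*} [NormedAddCommGroup H] [InnerProductSpace ℂ H]
    [CompleteSpace H] [Nontrivial H] {ρ ρ' : CplxCl Z →ₐ[ℂ] (H →L[ℂ] H)} (hρ : IsSkewRep ρ)
    (hρ' : IsSkewRep ρ') {ι : Type*} {v : ι → Z}
    (hd : (Submodule.span ℝ (Set.range v)).topologicalClosure = ⊤)
    (h : ∀ i, ρ (1 ⊗ₜ[ℝ] clGen (v i)) = ρ' (1 ⊗ₜ[ℝ] clGen (v i))) : ρ = ρ' := by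
  have hgen : ∀ v, genAction ρ v = genAction ρ' v := by
    refine dense_span_induction hd (p := fun v => genAction ρ v = genAction ρ' v) ?_ ?_ ?_ ?_ ?_
    · exact isClosed_eq hρ.continuous_genAction hρ'.continuous_genAction
    · exact h
    · simp
    · intro x y hx hy; rw [map_add, map_add, hx, hy]
    · intro r x hx; rw [map_smul, map_smul, hx]
  apply (AlgHom.liftEquiv ℝ ℂ (RealCl Z) (H →L[ℂ] H)).symm.injective
  apply CliffordAlgebra.hom_ext
  exact LinearMap.ext hgen

theorem exists_rep_of_clifford_relations {H : Type*} [NormedAddCommGroup H] [InnerProductSpace ℂ H]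
    [CompleteSpace H] [Nontrivial H] {ι : Type*} {v : ι → Z} (hv : Orthonormal ℝ v)
    (hd : (Submodule.span ℝ (Set.range v)).topologicalClosure = ⊤) {a : ι → (H →L[ℂ] H)}
    (hskew : ∀ i, star (a i) = -a i) (hsq : ∀ i, a i * a i = -1)
    (hanti : ∀ i j, i ≠ j → a i * a j = -(a j * a i)) :
    ∃ ρ : CplxCl Z →ₐ[ℂ] (H →L[ℂ] H), IsSkewRep ρ ∧
      ∀ i, ρ (1 ⊗ₜ[ℝ] clGen (v i)) = a i := by
  obtain ⟨J, hJ, hJskew, hJsq⟩ := hv.exists_clifford_extension hd hskew hsq hanti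
  let g : RealCl Z →ₐ[ℝ] (H →L[ℂ] H) := CliffordAlgebra.lift (negNormSq Z) ⟨J.toLinearMap, fun m => by
    rw [negNormSq_apply]; exact hJsq m⟩
  have hg : ∀ m, g (clGen m) = J m := fun m => CliffordAlgebra.lift_ι_apply _ _ m
  have hρ : ∀ m, AlgHom.liftEquiv ℝ ℂ (RealCl Z) (H →L[ℂ] H) g (1 ⊗ₜ[ℝ] clGen m) = J m := fun m => by
    rw [AlgHom.liftEquiv_tmul, one_smul, hg]
  refine ⟨AlgHom.liftEquiv ℝ ℂ (RealCl Z) (H →L[ℂ] H) g, fun m => ?_, fun i => ?_⟩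
  · rw [hρ]; exact hJskew m
  · rw [hρ, hJ]

end Representation

/-! ### From trivial commutant to irreducibility. -/

/-- A closed subspace that is invariant under skew-adjoint operators with trivial commutant is
trivial. -/
theorem eq_bot_or_top_of_trivial_commutant {H : Type*} [NormedAddCommGroup H]
    [InnerProductSpace ℂ H] [CompleteSpace H] {ι : Type*} {a : ι → (H →L[ℂ] H)}
    (hskew : ∀ i, star (a i) = -a i)
    (hcomm : ∀ B : H →L[ℂ] H, (∀ i, Commute B (a i)) → ∃ c : ℂ, B = c • 1)
    {U : Submodule ℂ H} (hU : IsClosed (U : Set H)) (hinv : ∀ i, ∀ v ∈ U, a i v ∈ U) :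
    U = ⊥ ∨ U = ⊤ := by
  have : CompleteSpace U := hU.completeSpace_coe
  -- Skewness makes the orthogonal complement invariant too, so the projection commutes with every
  -- `a i`.
  obtain ⟨c, hc⟩ := hcomm U.starProjection fun i => by
    have horth : ∀ w ∈ Uᗮ, a i w ∈ Uᗮ := fun w hw => by
      rw [Submodule.mem_orthogonal] at hw ⊢
      intro u hu
      rw [← ContinuousLinearMap.adjoint_inner_left, ← ContinuousLinearMap.star_eq_adjoint, hskew,
        neg_apply, inner_neg_left, hw _ (hinv i u hu), neg_zero]
    ext1 v
    change U.starProjection (a i v) = a i (U.starProjection v)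
    refine (Submodule.eq_starProjection_of_mem_orthogonal
      (hinv i _ (U.starProjection_apply_mem v)) ?_)
    rw [← map_sub]
    exact horth _ (U.sub_starProjection_mem_orthogonal v)
  by_cases h0 : c = 0
  · left
    rw [eq_bot_iff]
    intro v hv
    rw [← Submodule.starProjection_eq_self_iff, hc, h0, zero_smul] at hv
    exact hv.symm
  · right
    rw [eq_top_iff]
    intro v _
    have h := U.starProjection_apply_mem (c⁻¹ • v)
    rw [hc] at h
    simpa [smul_smul, h0] using h

/-! ### Real structures and complexification. -/

section RealStructure

variable {H : Type*} [NormedAddCommGroup H] [NormedSpace ℂ H] [NormedSpace ℝ H]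
  [IsScalarTower ℝ ℂ H]

/-- `K` is a continuous conjugation of `H`, and `F` the real subspace that it fixes. -/
structure IsRealStructure (K : H →L[ℝ] H) (F : Submodule ℝ H) : Prop where
  conj_smul : ∀ (c : ℂ) (f : H), K (c • f) = conj c • K f
  involutive : ∀ f, K (K f) = f
  mem_iff : ∀ f, f ∈ F ↔ K f = f

theorem complex_smul_eq (c : ℂ) (f : H) : c • f = c.re • f + c.im • (Complex.I • f) := by
  rw [← algebraMap_smul ℂ c.re f, ← algebraMap_smul ℂ c.im (Complex.I • f), smul_smul, ← add_smul]
  congr 1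
  exact (Complex.re_add_im c).symm

namespace IsRealStructure

variable {K : H →L[ℝ] H} {F : Submodule ℝ H} (hK : IsRealStructure K F)
include hK

theorem exists_rePart : ∃ R : H →L[ℝ] F, ∀ f, (R f : H) = (2⁻¹ : ℝ) • (f + K f) :=
  ⟨((2⁻¹ : ℝ) • (ContinuousLinearMap.id ℝ H + K)).codRestrict F fun f => by
    rw [hK.mem_iff]
    simp [hK.involutive, add_comm], fun _ => rfl⟩

/-- The real part `f ↦ (f + K f) / 2`. -/
noncomputable def rePart : H →L[ℝ] F := hK.exists_rePart.choose

theorem coe_rePart (f : H) : (hK.rePart f : H) = (2⁻¹ : ℝ) • (f + K f) :=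
  hK.exists_rePart.choose_spec f

theorem rePart_coe (u : F) : hK.rePart u = u := by
  apply Subtype.ext
  rw [coe_rePart, (hK.mem_iff u).1 u.2, ← two_smul ℝ, smul_smul]
  norm_num

theorem rePart_I_smul_coe (u : F) : hK.rePart (Complex.I • (u : H)) = 0 := by
  apply Subtype.ext
  rw [coe_rePart, hK.conj_smul, (hK.mem_iff u).1 u.2, Complex.conj_I]
  simp

theorem rePart_I_smul_I_smul (f : H) :
    hK.rePart (Complex.I • Complex.I • f) = -hK.rePart f := by
  rw [smul_smul, Complex.I_mul_I, neg_one_smul, map_neg]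

theorem eq_rePart_sub (f : H) :
    f = hK.rePart f - Complex.I • (hK.rePart (Complex.I • f) : H) := by
  rw [coe_rePart, coe_rePart, hK.conj_smul, Complex.conj_I, smul_comm Complex.I (2⁻¹ : ℝ),
    ← smul_sub, smul_add Complex.I, smul_smul, smul_smul, mul_neg, Complex.I_mul_I, neg_neg,
    one_smul, neg_one_smul, show f + K f - (-f + K f) = (2 : ℝ) • f by rw [two_smul]; abel,
    smul_smul]
  norm_num

theorem nontrivial [Nontrivial H] : Nontrivial F := by
  by_contra h
  rw [not_nontrivial_iff_subsingleton] at h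
  obtain ⟨f, hf⟩ := exists_ne (0 : H)
  apply hf
  rw [hK.eq_rePart_sub f, Subsingleton.elim (hK.rePart f) 0,
    Subsingleton.elim (hK.rePart (Complex.I • f)) 0]
  simp

/-- Taking real parts intertwines `T` with its restriction because `T` commutes with `K`. -/
theorem rePart_apply_of_commute {T : H →L[ℂ] H} (hT : ∀ f, K (T f) = T (K f)) {S : F →L[ℝ] F}
    (hS : ∀ u : F, (S u : H) = T u) (f : H) : hK.rePart (T f) = S (hK.rePart f) := by
  apply Subtype.ext
  rw [hS, coe_rePart, coe_rePart, hT, ← algebraMap_smul ℂ (2⁻¹ : ℝ), ← algebraMap_smul ℂ (2⁻¹ : ℝ),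
    map_smul, map_add]

variable {A : Type*} [Ring A] [Algebra ℝ A] {ρ : A → (H →L[ℂ] H)} {ρR : A →ₐ[ℝ] (F →L[ℝ] F)}
  (hρ : ∀ a f, K (ρ a f) = ρ a (K f)) (hR : ∀ a (u : F), (ρR a u : H) = ρ a u)
include hρ hR

theorem isIrredRep [Nontrivial H]
    (hirr : ∀ U : Submodule ℂ H, IsClosed (U : Set H) → (∀ a, ∀ v ∈ U, ρ a v ∈ U) →
      U = ⊥ ∨ U = ⊤) : IsIrredRep ρR := by
  refine ⟨hK.nontrivial, fun U hU hinv => ?_⟩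
  have hsm : ∀ (c : ℂ) (f : H), hK.rePart f ∈ U → hK.rePart (Complex.I • f) ∈ U →
      hK.rePart (c • f) ∈ U := fun c f h1 h2 => by
    rw [complex_smul_eq, map_add, map_smul, map_smul]
    exact U.add_mem (U.smul_mem _ h1) (U.smul_mem _ h2)
  -- The complexification U + iU, described through real and imaginary parts so that closedness and
  -- invariance are inherited from `U`.
  let V : Submodule ℂ H :=
    { carrier := {f | hK.rePart f ∈ U ∧ hK.rePart (Complex.I • f) ∈ U}
      zero_mem' := by simp
      add_mem' := fun {f g} hf hg => by
        simp only [Set.mem_ofPred_eq, smul_add, map_add] at hf hg ⊢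
        exact ⟨U.add_mem hf.1 hg.1, U.add_mem hf.2 hg.2⟩
      smul_mem' := fun c f hf => by
        refine ⟨hsm c f hf.1 hf.2, ?_⟩
        rw [smul_comm]
        refine hsm c _ hf.2 ?_
        rw [rePart_I_smul_I_smul]
        exact U.neg_mem hf.1 }
  have hV : IsClosed (V : Set H) := by
    refine IsClosed.inter (hU.preimage hK.rePart.continuous) (hU.preimage ?_)
    exact hK.rePart.continuous.comp (continuous_const_smul Complex.I)
  have hVinv : ∀ a, ∀ v ∈ V, ρ a v ∈ V := fun a v hv => by
    change hK.rePart (ρ a v) ∈ U ∧ hK.rePart (Complex.I • ρ a v) ∈ U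
    rw [← map_smul, hK.rePart_apply_of_commute (hρ a) (hR a),
      hK.rePart_apply_of_commute (hρ a) (hR a)]
    exact ⟨hinv a _ hv.1, hinv a _ hv.2⟩
  rcases hirr V hV hVinv with h | h
  · left
    rw [eq_bot_iff]
    intro u hu
    have : (u : H) ∈ V := by
      refine ⟨by rwa [hK.rePart_coe], ?_⟩
      rw [hK.rePart_I_smul_coe]
      exact U.zero_mem
    rw [h] at this
    exact Subtype.ext this
  · right
    rw [eq_top_iff]
    intro u _
    have : (u : H) ∈ V := by rw [h]; trivial
    rw [← hK.rePart_coe u]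
    exact this.1

/-- A real structure that is invariant under operators with trivial commutant admits no invariant
complex structure. -/
theorem mul_self_ne_neg_one_of_commute [Nontrivial H]
    (hcomm : ∀ B : H →L[ℂ] H, (∀ a, Commute B (ρ a)) → ∃ c : ℂ, B = c • 1) {j : F →L[ℝ] F}
    (hj : ∀ a, Commute j (ρR a)) : j * j ≠ -1 := by
  intro hjj
  -- The complex-linear extension of `j`, read off from the decomposition `eq_rePart_sub`.
  let b : H → H := fun f =>
    (j (hK.rePart f) : H) - Complex.I • (j (hK.rePart (Complex.I • f)) : H)
  have hbI : ∀ f, b (Complex.I • f) = Complex.I • b f := fun f => by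
    simp only [b]
    rw [rePart_I_smul_I_smul, smul_sub, smul_smul, Complex.I_mul_I]
    simp [add_comm]
  have hbr : ∀ (r : ℝ) f, b (r • f) = r • b f := fun r f => by
    simp only [b]
    rw [smul_comm Complex.I r, map_smul, map_smul, map_smul, map_smul, Submodule.coe_smul,
      Submodule.coe_smul, smul_comm Complex.I r, smul_sub]
  have hba : ∀ f g, b (f + g) = b f + b g := fun f g => by
    simp only [b, smul_add, map_add, Submodule.coe_add]
    abel
  have hbc : Continuous b := by fun_prop
  let B : H →L[ℂ] H :=
    { toFun := b
      map_add' := hba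
      map_smul' := fun c f => by
        rw [complex_smul_eq, hba, hbr, hbr, hbI, RingHom.id_apply, ← complex_smul_eq]
      cont := hbc }
  have hB : ∀ a, Commute B (ρ a) := fun a => by
    ext1 f
    change b (ρ a f) = ρ a (b f)
    simp only [b]
    have hja : ∀ u, j (ρR a u) = ρR a (j u) := fun u => DFunLike.congr_fun (hj a) u
    rw [← (ρ a).map_smul, hK.rePart_apply_of_commute (hρ a) (hR a),
      hK.rePart_apply_of_commute (hρ a) (hR a), hja, hja, hR, hR, map_sub,
      (ρ a).map_smul]
  obtain ⟨c, hc⟩ := hcomm B hB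
  have hju : ∀ u : F, (j u : H) = c • (u : H) := fun u => by
    have h : b u = c • (u : H) := DFunLike.congr_fun hc (u : H)
    rw [← h]
    simp only [b]
    rw [hK.rePart_coe, hK.rePart_I_smul_coe]
    simp
  have := hK.nontrivial
  obtain ⟨u, hu⟩ := exists_ne (0 : F)
  have hu' : (u : H) ≠ 0 := fun h => hu (Subtype.ext h)
  have h1 : (c * c) • (u : H) = (-1 : ℂ) • (u : H) := by
    rw [mul_smul, ← hju, ← hju]
    have : j (j u) = -u := DFunLike.congr_fun hjj u
    rw [this]
    simp
  -- `K` fixes both `u` and `j u = c • u`, so `c` is real, against `c * c = -1`.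
  have h2 : conj c • (u : H) = c • (u : H) := by
    have h := (hK.mem_iff _).1 (j u).2
    rwa [hju, hK.conj_smul, (hK.mem_iff _).1 u.2] at h
  have h1' := smul_left_injective ℂ hu' h1
  have h2' := Complex.conj_eq_iff_im.1 (smul_left_injective ℂ hu' h2)
  have h3 := congrArg Complex.re h1'
  simp [h2'] at h3
  nlinarith [mul_self_nonneg c.re]

end IsRealStructure

end RealStructure

/-! ### The conjugation defining the real form. -/

section ConjReflect

variable (μ : Measure BinSeq) [μ.IsAddHaarMeasure]

/-- The conjugation `f ↦ conj (f (1 - ·))` of `L²`. -/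
noncomputable def conjReflect : Lp ℂ 2 μ →L[ℝ] Lp ℂ 2 μ :=
  ((Complex.conjCLE : ℂ →L[ℝ] ℂ).compLpL 2 μ).comp
    (Lp.compMeasurePreservingₗᵢ ℝ (1 - ·)
      (Measure.measurePreserving_sub_left μ (1 : BinSeq))).toContinuousLinearMap

theorem coeFn_conjReflect (f : Lp ℂ 2 μ) :
    conjReflect μ f =ᵐ[μ] fun x => conj (f (1 - x)) := by
  have h1 := ContinuousLinearMap.coeFn_compLpL (Complex.conjCLE : ℂ →L[ℝ] ℂ)
    (Lp.compMeasurePreservingₗᵢ ℝ (1 - ·) (Measure.measurePreserving_sub_left μ (1 : BinSeq)) f)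
  have h2 := Lp.coeFn_compMeasurePreserving f (Measure.measurePreserving_sub_left μ (1 : BinSeq))
  refine EventuallyEq.trans h1 ?_
  filter_upwards [h2] with x hx
  exact congrArg conj hx

theorem ae_comp_one_sub {p : BinSeq → Prop} (h : ∀ᵐ x ∂μ, p x) : ∀ᵐ x ∂μ, p (1 - x) :=
  (BinSeq.quasiMeasurePreserving_one_sub μ).ae h

theorem isRealStructure_conjReflect : IsRealStructure (conjReflect μ) (realForm μ) where
  conj_smul c f := by
    apply Lp.ext
    filter_upwards [coeFn_conjReflect μ (c • f), ae_comp_one_sub μ (Lp.coeFn_smul c f),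
      Lp.coeFn_smul (conj c) (conjReflect μ f), coeFn_conjReflect μ f] with x h1 h2 h3 h4
    rw [h1, h2, h3]
    simp [h4]
  involutive f := by
    apply Lp.ext
    filter_upwards [coeFn_conjReflect μ (conjReflect μ f),
      ae_comp_one_sub μ (coeFn_conjReflect μ f)] with x h1 h2
    rw [h1, h2]
    simp
  mem_iff f := by
    constructor
    · intro h
      apply Lp.ext
      filter_upwards [coeFn_conjReflect μ f, h] with x h1 h2
      rw [h1, h2, Complex.conj_conj]
    · intro h
      change (fun x => f (1 - x)) =ᵐ[μ] fun x => conj (f x)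
      have h1 := coeFn_conjReflect μ f
      rw [h] at h1
      filter_upwards [h1] with x hx
      rw [hx, Complex.conj_conj]

/-- Reflection commutes with the shift since 1 − (x + δ) = (1 − x) + δ in exponent 2, and the weight
is unchanged by reflection followed by conjugation. -/
theorem conjReflect_basisOp (t : ℕ+ ⊕ ℕ+) (f : Lp ℂ 2 μ) :
    conjReflect μ (basisOp μ t f) = basisOp μ t (conjReflect μ f) := by
  apply Lp.ext
  filter_upwards [coeFn_conjReflect μ (basisOp μ t f),
    ae_comp_one_sub μ (coeFn_weightedShift μ (BinSeq.delta (basisIndex t)) (basisWeight t) f),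
    coeFn_weightedShift μ (BinSeq.delta (basisIndex t)) (basisWeight t) (conjReflect μ f),
    ae_comp_add_right μ (BinSeq.delta (basisIndex t)) (coeFn_conjReflect μ f)] with x h1 h2 h3 h4
  rw [h1]
  refine Eq.trans ?_ h3.symm
  rw [h4]
  refine (congrArg conj h2).trans ?_
  rw [map_mul, conj_basisWeight_one_sub, ← sub_sub, sub_eq_add_neg (1 - x), BinSeq.neg_eq]

end ConjReflect

/-! ### Passing from generators to the real Clifford algebra. -/

section Clifford

variable {Z : Type*} [NormedAddCommGroup Z] [InnerProductSpace ℝ Z]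

theorem genAction_smul {H : Type*} [NormedAddCommGroup H] [InnerProductSpace ℂ H]
    (ρ : CplxCl Z →ₐ[ℂ] (H →L[ℂ] H)) (r : ℝ) (x : Z) :
    genAction ρ (r • x) = (r : ℂ) • genAction ρ x :=
  (map_smul (genAction ρ) r x).trans (Complex.coe_smul r _).symm

/-- A bounded real-linear operator commuting with the generators given by a basis commutes with
the real Clifford algebra. -/
theorem IsSkewRep.map_apply_of_basis {H : Type*} [NormedAddCommGroup H] [InnerProductSpace ℂ H]
    [CompleteSpace H] [Nontrivial H] [NormedSpace ℝ H] [IsScalarTower ℝ ℂ H]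
    {ρ : CplxCl Z →ₐ[ℂ] (H →L[ℂ] H)} (hρ : IsSkewRep ρ)
    {ι : Type*} {v : ι → Z} (hd : (Submodule.span ℝ (Set.range v)).topologicalClosure = ⊤)
    {K : H →L[ℝ] H}
    (h : ∀ i f, K (ρ (1 ⊗ₜ[ℝ] clGen (v i)) f) = ρ (1 ⊗ₜ[ℝ] clGen (v i)) (K f)) (a : RealCl Z)
    (f : H) : K (ρ (1 ⊗ₜ[ℝ] a) f) = ρ (1 ⊗ₜ[ℝ] a) (K f) := by
  have hgen : ∀ (w : Z) (f : H), K (genAction ρ w f) = genAction ρ w (K f) := by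
    intro w f
    have hsmul : ∀ (r : ℝ) (x : Z) (g : H), genAction ρ (r • x) g = r • genAction ρ x g :=
      fun r x g => by
        rw [genAction_smul, ← algebraMap_smul ℂ r]
        rfl
    refine dense_span_induction hd (p := fun w => K (genAction ρ w f) = genAction ρ w (K f))
      ?_ ?_ ?_ ?_ ?_ w
    · have := hρ.continuous_genAction
      exact isClosed_eq (by fun_prop) (by fun_prop)
    · exact fun i => h i f
    · simp
    · intro x y hx hy
      rw [map_add, add_apply, add_apply, map_add, hx, hy]
    · intro r x hx
      rw [hsmul, hsmul, map_smul, hx]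
  induction a using CliffordAlgebra.induction generalizing f with
  | algebraMap r =>
    have : ∀ g, ρ (1 ⊗ₜ[ℝ] algebraMap ℝ (RealCl Z) r) g = r • g := fun g => by
      rw [Algebra.algebraMap_eq_smul_one, TensorProduct.tmul_smul, ← Algebra.TensorProduct.one_def,
        ← algebraMap_smul ℂ r (1 : CplxCl Z), map_smul, map_one, ← algebraMap_smul ℂ r g]
      rfl
    rw [this, this, map_smul]
  | ι x => exact hgen x f
  | mul a b ha hb =>
    have : ∀ g, ρ (1 ⊗ₜ[ℝ] (a * b)) g = ρ (1 ⊗ₜ[ℝ] a) (ρ (1 ⊗ₜ[ℝ] b) g) := fun g => by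
      rw [← mul_one (1 : ℂ), ← Algebra.TensorProduct.tmul_mul_tmul, map_mul, mul_one]
      rfl
    rw [this, this, ha, hb]
  | add a b ha hb =>
    rw [TensorProduct.tmul_add, map_add, add_apply,
      add_apply, map_add, ha, hb]

/-- The restriction of a representation of the complexified Clifford algebra to a real subspace
that is invariant under the real Clifford algebra. -/
noncomputable def realRestrict {H : Type*} [NormedAddCommGroup H] [NormedSpace ℂ H]
    [NormedSpace ℝ H] [IsScalarTower ℝ ℂ H] (ρ : CplxCl Z →ₐ[ℂ] (H →L[ℂ] H)) (F : Submodule ℝ H)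
    (hF : ∀ (a : RealCl Z), ∀ f ∈ F, ρ (1 ⊗ₜ[ℝ] a) f ∈ F) : RealCl Z →ₐ[ℝ] (F →L[ℝ] F) where
  toFun a := (((ρ (1 ⊗ₜ[ℝ] a)).restrictScalars ℝ).comp F.subtypeL).codRestrict F
    fun f => hF a f f.2
  map_one' := by
    ext f
    change ρ (1 ⊗ₜ[ℝ] 1) (f : H) = f
    rw [← Algebra.TensorProduct.one_def, map_one]
    rfl
  map_mul' a b := by
    ext f
    change ρ (1 ⊗ₜ[ℝ] (a * b)) (f : H) = ρ (1 ⊗ₜ[ℝ] a) (ρ (1 ⊗ₜ[ℝ] b) f)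
    rw [← mul_one (1 : ℂ), ← Algebra.TensorProduct.tmul_mul_tmul, map_mul, mul_one]
    rfl
  map_zero' := by
    ext f
    change ρ (1 ⊗ₜ[ℝ] 0) (f : H) = 0
    rw [TensorProduct.tmul_zero, map_zero]
    rfl
  map_add' a b := by
    ext f
    change ρ (1 ⊗ₜ[ℝ] (a + b)) (f : H) = ρ (1 ⊗ₜ[ℝ] a) f + ρ (1 ⊗ₜ[ℝ] b) f
    rw [TensorProduct.tmul_add, map_add]
    rfl
  commutes' r := by
    ext f
    change ρ (1 ⊗ₜ[ℝ] algebraMap ℝ (RealCl Z) r) (f : H) = r • (f : H)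
    rw [Algebra.algebraMap_eq_smul_one, TensorProduct.tmul_smul, ← Algebra.TensorProduct.one_def,
      ← algebraMap_smul ℂ r (1 : CplxCl Z), map_smul, map_one, ← algebraMap_smul ℂ r (f : H)]
    rfl

end Clifford

/-! ### Assembly of the theorem. -/

theorem theorem3p11 {Z : Type*} [NormedAddCommGroup Z] [InnerProductSpace ℝ Z]
    (σ : Z →ₗᵢ[ℝ] Z) (hσ : ∀ v : Z, σ (σ v) = -v) (z : ℕ+ → Z)
    (hz : Orthonormal ℝ (Sum.elim z (fun k => σ (z k))))
    (hz_dense : (Submodule.span ℝ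
      (Set.range (Sum.elim z (fun k => σ (z k))))).topologicalClosure = ⊤)
    (μ : Measure BinSeq) [μ.IsAddHaarMeasure] :
    IsGWCoeff splitCoeff ∧
    ∃ ρ : CplxCl Z →ₐ[ℂ] (Lp ℂ 2 μ →L[ℂ] Lp ℂ 2 μ),
      IsGWRep σ z μ splitCoeff ρ ∧
      (∀ ρ' : CplxCl Z →ₐ[ℂ] (Lp ℂ 2 μ →L[ℂ] Lp ℂ 2 μ),
        IsGWRep σ z μ splitCoeff ρ' → ρ' = ρ) ∧
      IsIrredRep ρ ∧
      (∀ (a : RealCl Z), ∀ f ∈ realForm μ, ρ (1 ⊗ₜ[ℝ] a) f ∈ realForm μ) ∧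
      ∃ ρR : RealCl Z →ₐ[ℝ] (realForm μ →L[ℝ] realForm μ),
        (∀ (a : RealCl Z) (f : realForm μ),
          (ρR a f : Lp ℂ 2 μ) = ρ (1 ⊗ₜ[ℝ] a) (f : Lp ℂ 2 μ)) ∧
        IsIrredRep ρR ∧
        ∀ (W : Type*) [NormedAddCommGroup W] [InnerProductSpace ℂ W] [CompleteSpace W]
          (τ : CplxCl Z →ₐ[ℂ] (W →L[ℂ] W)),
          ¬ ∃ φ : realForm μ ≃L[ℝ] W, ∀ (a : RealCl Z) (f : realForm μ),
            φ (ρR a f) = τ (1 ⊗ₜ[ℝ] a) (φ f) := by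
  refine ⟨isGWCoeff_splitCoeff, ?_⟩
  obtain ⟨ρ, hskew, hbasis⟩ := exists_rep_of_clifford_relations (v := realBasis σ z) hz hz_dense
    (star_basisOp μ) (basisOp_mul_self μ) (fun _ _ h => basisOp_anticomm μ h)
  have hK := isRealStructure_conjReflect μ
  have hKρ : ∀ (a : RealCl Z) f, conjReflect μ (ρ (1 ⊗ₜ[ℝ] a) f) =
      ρ (1 ⊗ₜ[ℝ] a) (conjReflect μ f) :=
    hskew.map_apply_of_basis hz_dense fun t f => by
      have := conjReflect_basisOp μ t f
      rw [← hbasis] at this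
      exact this
  have hF : ∀ (a : RealCl Z), ∀ f ∈ realForm μ, ρ (1 ⊗ₜ[ℝ] a) f ∈ realForm μ := fun a f hf => by
    rw [hK.mem_iff] at hf ⊢
    rw [hKρ, hf]
  have hR : ∀ (a : RealCl Z) (f : realForm μ),
      (realRestrict ρ (realForm μ) hF a f : Lp ℂ 2 μ) = ρ (1 ⊗ₜ[ℝ] a) (f : Lp ℂ 2 μ) :=
    fun _ _ => rfl
  -- Invariance is asked only under the real Clifford algebra, so this serves both the complex and
  -- the real irreducibility.
  have hirr : ∀ U : Submodule ℂ (Lp ℂ 2 μ), IsClosed (U : Set (Lp ℂ 2 μ)) →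
      (∀ a : RealCl Z, ∀ v ∈ U, ρ (1 ⊗ₜ[ℝ] a) v ∈ U) → U = ⊥ ∨ U = ⊤ := fun U hU hinv =>
    eq_bot_or_top_of_trivial_commutant (star_basisOp μ)
      (fun _ hB => exists_eq_smul_one_of_commute_basisOp μ hB) hU fun t v hv => by
        rw [← hbasis]; exact hinv _ v hv
  refine ⟨ρ, (isGWRep_splitCoeff_iff μ ρ).2 ⟨hskew, hbasis⟩, fun ρ' hρ' => ?_,
    ⟨inferInstance, fun U hU hinv => hirr U hU fun a => hinv _⟩, hF,
    realRestrict ρ (realForm μ) hF, hR, hK.isIrredRep hKρ hR hirr, ?_⟩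
  · rw [isGWRep_splitCoeff_iff] at hρ'
    exact hρ'.1.ext_of_basis hskew hz_dense fun t => (hρ'.2 t).trans (hbasis t).symm
  · rintro W _ _ _ τ ⟨φ, hφ⟩
    -- Multiplication by i on `W`, transported to the real form; it commutes with C(Z) because `τ`
    -- acts by complex-linear operators.
    let j : realForm μ →L[ℝ] realForm μ := (φ.symm : W →L[ℝ] realForm μ).comp
      (((Complex.I • (1 : W →L[ℂ] W)).restrictScalars ℝ).comp (φ : realForm μ →L[ℝ] W))
    have hj : ∀ f, φ (j f) = Complex.I • φ f := fun f => φ.apply_symm_apply _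
    refine hK.mul_self_ne_neg_one_of_commute hKρ hR (fun B hB => ?_) (j := j) (fun a => ?_) ?_
    · exact exists_eq_smul_one_of_commute_basisOp μ fun t => by
        rw [← hbasis]; exact hB _
    · ext1 f
      apply φ.injective
      change φ (j (realRestrict ρ (realForm μ) hF a f)) = φ (realRestrict ρ (realForm μ) hF a (j f))
      rw [hj, hφ, hφ, hj, map_smul]
    · ext1 f
      apply φ.injective
      change φ (j (j f)) = φ (-f)
      rw [hj, hj, smul_smul, Complex.I_mul_I, neg_one_smul, map_neg]
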